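/- Let $\pi=(p_1,p_2,\ldots)$ be any infinite sequence of primes (repetitions allowed). Then there exists a finitely generated infinite group $Q$ that is periodic (every element of $Q$ has finite order) and $\pi$-graded, that is, $Q$ admits a descending series $Q=Q_0\supseteq Q_1\supseteq Q_2\supseteq\cdots$ of normal subgroups of $Q$ such that $\bigcap_{i} Q_i=\{1\}$ and, for every $i\ge 1$, the factor $Q_{i-1}/Q_i$ is either trivial or abelian of exponent $p_i$. -/

import Mathlib

/-- `S` is a `π`-graded series of the group `G`, for the infinite sequence of primes
`π = (p 0, p 1, p 2, …)`: a descending series `G = S 0 ⊇ S 1 ⊇ S 2 ⊇ …` of normal subgroups of `G`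
with trivial intersection, such that every factor `S i / S (i + 1)` is either trivial or an abelian
group of exponent `p i`. -/
structure IsPiGradedSeries (p : ℕ → ℕ) {G : Type*} [Group G] (S : ℕ → Subgroup G) : Prop where
  zero_eq_top : S 0 = ⊤
  normal : ∀ i, (S i).Normal
  succ_le : ∀ i, S (i + 1) ≤ S i
  iInf_eq_bot : ⨅ i, S i = ⊥
  factor : ∀ i,
    Subsingleton (S i ⧸ (S (i + 1)).subgroupOf (S i)) ∨
      ((∀ a b : S i ⧸ (S (i + 1)).subgroupOf (S i), a * b = b * a) ∧
        Monoid.exponent (S i ⧸ (S (i + 1)).subgroupOf (S i)) = p i)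

/-- A group is `π`-graded if it admits a `π`-graded series. -/
def IsPiGraded (p : ℕ → ℕ) (G : Type*) [Group G] : Prop :=
  ∃ S : ℕ → Subgroup G, IsPiGradedSeries p S

/-!
Let `F` be free of rank two, with elements `g 0, g 1, …`. Put `D 0 = F` and let `D (i + 1)` be the
normal closure of the commutators and `p i`-th powers of elements of `D i`, together with all powers
`g j ^ m` where `m` is the order of `g j` modulo `D i`, provided that `m ≥ 2 ^ (j + 2)`. The group
is the quotient of `F` by the intersection of the `D i`.

The factors of the series are abelian of exponent dividing `p i` by construction
(`isPiGraded_quotient_iInf_series`), and all terms have finite index (`finiteIndex_step`). The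
quotient is periodic (`exists_pow_mem_iInf_series`): once the order of `g j` modulo a term reaches
`2 ^ (j + 2)`, the definition freezes it, and otherwise it stays bounded.

The quotient is infinite because every step is strict (`step_lt`). Let `H = D i`, `P = F / H`,
`n = |P|` and `K` the field with `p i` elements. Crossed homomorphisms from `F` to the module of
functions `P → K` form a space of dimension `2 n`, since the values on the free generators are
arbitrary. Evaluation at `1 : P` turns a crossed homomorphism into a homomorphism `H → K`, which
kills commutators and `p i`-th powers. If it vanishes on `H`, then the crossed homomorphism is determined
by `n` values, one for each element of a section of `F → P`. If `m` is the order of `g j` modulo `H`,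
then the value at `g j ^ m` is a function on `P` invariant under `g j`, so killing all conjugates of
`g j ^ m` costs only `n / m ≤ n / 2 ^ (j + 2)` linear conditions. These are fewer than `2 n`
conditions altogether, so some crossed homomorphism satisfies all conditions on relators without vanishing on
`H` (`exists_cocycle_ne_zero`). Its restriction to `H` is nonzero and kills `D (i + 1)`.
-/

/-! ### The generic crossed homomorphism of a free group -/

section Cocycle

variable {S P : Type*} (K : Type*) [Field K] [Group P] (q : FreeGroup S →* P)

/-- The homomorphism from the free group on `S` to the wreath product of the additive group of the
dual of `S × P → K` with `P` that lies over `q` and sends a generator `s` to the family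
`x ↦ (φ ↦ φ (s, x))` of coordinate functionals. -/
def genericHom :
    FreeGroup S →* RegularWreathProduct (Multiplicative (Module.Dual K (S × P → K))) P :=
  FreeGroup.lift fun s => ⟨fun x => .ofAdd (LinearMap.proj (s, x)), q (.of s)⟩

/-- The generic crossed homomorphism over `q : FreeGroup S →* P` with values in functions on `P`.
A crossed homomorphism from a free group to `P → K` is determined by arbitrary values `φ (s, x)` on
the generators, and `genericCocycle K q g x φ` is the value at `g` and `x` of the one given by `φ`.
Keeping `φ` as the argument of a functional makes the linearity in `φ` automatic. -/
def genericCocycle (g : FreeGroup S) (x : P) : Module.Dual K (S × P → K) :=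
  ((genericHom K q g).left x).toAdd

lemma genericHom_right (g : FreeGroup S) : (genericHom K q g).right = q g := by
  have h : RegularWreathProduct.rightHom.comp (genericHom K q) = q := by
    ext s
    simp [genericHom]
  exact DFunLike.congr_fun h g

lemma genericCocycle_of (s : S) (x : P) :
    genericCocycle K q (.of s) x = LinearMap.proj (s, x) := by
  simp [genericCocycle, genericHom]

lemma genericCocycle_one (x : P) : genericCocycle K q 1 x = 0 := by
  simp [genericCocycle]

lemma genericCocycle_mul (g h : FreeGroup S) (x : P) :
    genericCocycle K q (g * h) x = genericCocycle K q g x + genericCocycle K q h ((q g)⁻¹ * x) := by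
  simp [genericCocycle, genericHom_right]

lemma genericCocycle_conj (t : FreeGroup S) {r : FreeGroup S} (hr : q r = 1) :
    genericCocycle K q (t * r * t⁻¹) 1 = genericCocycle K q r (q t)⁻¹ := by
  have h := genericCocycle_mul K q t t⁻¹ 1
  rw [mul_inv_cancel, genericCocycle_one] at h
  rw [genericCocycle_mul, genericCocycle_mul, map_mul, hr, mul_one (q t), add_right_comm, ← h,
    zero_add, mul_one]

/-- If `g ^ m` lies in the kernel of `q`, then the value of the crossed homomorphism at `g ^ m` is
a function on `P` invariant under `q g`; this follows from `g * g ^ m = g ^ m * g`. -/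
lemma genericCocycle_pow_inv_mul {g : FreeGroup S} {m : ℕ} (hm : q g ^ m = 1) (x : P) :
    genericCocycle K q (g ^ m) ((q g)⁻¹ * x) = genericCocycle K q (g ^ m) x := by
  have h := genericCocycle_mul K q g (g ^ m) x
  rw [← pow_succ', pow_succ, genericCocycle_mul, map_pow, hm, inv_one, one_mul, add_comm] at h
  exact (add_left_cancel h).symm

lemma genericCocycle_pow_eq {g : FreeGroup S} {m : ℕ} (hm : q g ^ m = 1) {x y : P}
    (hxy : x⁻¹ * y ∈ Subgroup.zpowers (q g)) :
    genericCocycle K q (g ^ m) x⁻¹ = genericCocycle K q (g ^ m) y⁻¹ := by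
  have key : ∀ z ∈ Subgroup.zpowers (q g), ∀ u,
      genericCocycle K q (g ^ m) (z⁻¹ * u) = genericCocycle K q (g ^ m) u := by
    intro z hz
    rw [Subgroup.zpowers_eq_closure] at hz
    induction hz using Subgroup.closure_induction with
    | mem z hz =>
      rw [Set.mem_singleton_iff] at hz
      subst hz
      exact genericCocycle_pow_inv_mul K q hm
    | one => simp
    | mul a b _ _ ha hb =>
      intro u
      rw [mul_inv_rev, mul_assoc, hb, ha]
    | inv a _ ha =>
      intro u
      rw [← ha, inv_inv, inv_mul_cancel_left]
  have h := key _ hxy x⁻¹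
  rw [← h]
  congr 1
  group

/-- A crossed homomorphism over a surjection `q` whose values have vanishing `1`-component on the
kernel of `q` and on a section of `q` is zero. -/
lemma eq_zero_of_genericCocycle_eq_zero {φ : S × P → K} {σ : P → FreeGroup S}
    (hσ : ∀ x, q (σ x) = x) (hker : ∀ h, q h = 1 → genericCocycle K q h 1 φ = 0)
    (hsec : ∀ x, genericCocycle K q (σ x) 1 φ = 0) : φ = 0 := by
  have hall : ∀ g, genericCocycle K q g 1 φ = 0 := by
    intro g
    have hq : q (g * (σ (q g))⁻¹) = 1 := by rw [map_mul, map_inv, hσ, mul_inv_cancel]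
    have h := genericCocycle_mul K q (g * (σ (q g))⁻¹) (σ (q g)) 1
    rw [inv_mul_cancel_right, hq, inv_one, one_mul] at h
    rw [h, LinearMap.add_apply, hker _ hq, hsec, add_zero]
  ext ⟨s, x⟩
  have h := DFunLike.congr_fun (genericCocycle_mul K q (σ x⁻¹) (.of s) 1) φ
  rw [LinearMap.add_apply, hall, hall, zero_add, genericCocycle_of, hσ, inv_inv, mul_one] at h
  exact h.symm

/-- Given relators `g j ^ orderOf (q (g j))` with `∑ 1 / orderOf (q (g j)) < |S| - 1`, some crossed
homomorphism over the surjection `q` restricts to a nonzero homomorphism on the kernel of `q` that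
kills all conjugates of the relators. -/
theorem exists_cocycle_ne_zero [Fintype S] [Finite P] (hq : Function.Surjective q) {ι : Type*}
    [Fintype ι] (g : ι → FreeGroup S)
    (hcard : ∑ j, Nat.card (P ⧸ Subgroup.zpowers (q (g j))) + Nat.card P <
      Fintype.card S * Nat.card P) :
    ∃ φ : S × P → K, (∃ h, q h = 1 ∧ genericCocycle K q h 1 φ ≠ 0) ∧
      ∀ j t, genericCocycle K q (t * g j ^ orderOf (q (g j)) * t⁻¹) 1 φ = 0 := by
  classical
  have := Fintype.ofFinite P
  obtain ⟨σ, hσ⟩ := hq.hasRightInverse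
  let T := (Σ j, P ⧸ Subgroup.zpowers (q (g j))) ⊕ P
  -- The conditions: values of the crossed homomorphism at the relators, one for each coset because
  -- of the invariance, and at a section of `q`.
  let f : T → Module.Dual K (S × P → K) := Sum.elim
    (fun z => genericCocycle K q (g z.1 ^ orderOf (q (g z.1))) z.2.out⁻¹)
    (fun x => genericCocycle K q (σ x) 1)
  have hlt : Module.finrank K (T → K) < Module.finrank K (S × P → K) := by
    rw [Module.finrank_fintype_fun_eq_card, Module.finrank_fintype_fun_eq_card, Fintype.card_sum,
      Fintype.card_sigma, Fintype.card_prod]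
    simpa only [Nat.card_eq_fintype_card] using hcard
  obtain ⟨φ, hφ, hne⟩ :=
    (Submodule.ne_bot_iff _).1 ((LinearMap.pi f).ker_ne_bot_of_finrank_lt hlt)
  have hφf : ∀ z, f z φ = 0 := fun z => congrFun (LinearMap.mem_ker.1 hφ) z
  refine ⟨φ, ?_, fun j t => ?_⟩
  · by_contra! hker
    exact hne (eq_zero_of_genericCocycle_eq_zero K q hσ hker fun x => hφf (.inr x))
  · have hpow : q (g j) ^ orderOf (q (g j)) = 1 := pow_orderOf_eq_one _
    rw [genericCocycle_conj K q t (by rw [map_pow, hpow])]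
    have hmem := QuotientGroup.eq.1
      (QuotientGroup.out_eq' (q t : P ⧸ Subgroup.zpowers (q (g j)))).symm
    rw [genericCocycle_pow_eq K q hpow hmem]
    exact hφf (.inl ⟨j, q t⟩)

end Cocycle

/-! ### One step of the series -/

section Step

open scoped commutatorElement

/-- The elements killed when passing from a normal subgroup `H` to the next term of the series:
commutators and `p`-th powers of elements of `H`, and the powers `g j ^ m` such that `m` is the
order of `g j` modulo `H` and this order is at least `2 ^ (j + 2)`. The order is described by
divisibility, so that no normality of `H` is needed; an infinite order gives `m = 0`, which does
not occur. -/
def stepRelators {G : Type*} [Group G] (g : ℕ → G) (p : ℕ) (H : Subgroup G) : Set G :=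
  {x | ∃ a ∈ H, ∃ b ∈ H, ⁅a, b⁆ = x} ∪ {x | ∃ a ∈ H, a ^ p = x} ∪
    {x | ∃ j m, 2 ^ (j + 2) ≤ m ∧ (∀ k, g j ^ k ∈ H ↔ m ∣ k) ∧ g j ^ m = x}

/-- The term of the series that follows `H`: the normal closure of `stepRelators g p H`. -/
def step {G : Type*} [Group G] (g : ℕ → G) (p : ℕ) (H : Subgroup G) : Subgroup G :=
  Subgroup.normalClosure (stepRelators g p H)

variable {G : Type*} [Group G] {g : ℕ → G} {p : ℕ} {H : Subgroup G}

instance : (step g p H).Normal := Subgroup.normalClosure_normal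

lemma commutatorElement_mem_step {a b : G} (ha : a ∈ H) (hb : b ∈ H) : ⁅a, b⁆ ∈ step g p H :=
  Subgroup.subset_normalClosure (.inl (.inl ⟨a, ha, b, hb, rfl⟩))

lemma pow_mem_step {a : G} (ha : a ∈ H) : a ^ p ∈ step g p H :=
  Subgroup.subset_normalClosure (.inl (.inr ⟨a, ha, rfl⟩))

lemma mk_pow_eq_one_iff [H.Normal] {a : G} {k : ℕ} : (a : G ⧸ H) ^ k = 1 ↔ a ^ k ∈ H := by
  rw [← QuotientGroup.mk_pow, QuotientGroup.eq_one_iff]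

lemma pow_orderOf_mem_step [H.Normal] {j : ℕ} (hj : 2 ^ (j + 2) ≤ orderOf (g j : G ⧸ H)) :
    g j ^ orderOf (g j : G ⧸ H) ∈ step g p H :=
  Subgroup.subset_normalClosure (.inr ⟨j, _, hj,
    fun k => by rw [orderOf_dvd_iff_pow_eq_one, mk_pow_eq_one_iff], rfl⟩)

lemma step_le [H.Normal] : step g p H ≤ H := by
  refine Subgroup.normalClosure_le_normal ?_
  rintro x ((⟨a, ha, b, hb, rfl⟩ | ⟨a, ha, rfl⟩) | ⟨j, m, -, hm, rfl⟩)
  · exact H.mul_mem (H.mul_mem (H.mul_mem ha hb) (H.inv_mem ha)) (H.inv_mem hb)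
  · exact H.pow_mem ha p
  · exact (hm m).2 dvd_rfl

/-- Once the order of `g j` modulo `H` has reached `2 ^ (j + 2)`, it no longer changes. -/
lemma orderOf_mk_step [H.Normal] {j : ℕ} (hj : 2 ^ (j + 2) ≤ orderOf (g j : G ⧸ H)) :
    orderOf (g j : G ⧸ step g p H) = orderOf (g j : G ⧸ H) := by
  refine Nat.dvd_antisymm ?_ ?_
  · rw [orderOf_dvd_iff_pow_eq_one, mk_pow_eq_one_iff]
    exact pow_orderOf_mem_step hj
  · rw [orderOf_dvd_iff_pow_eq_one, mk_pow_eq_one_iff]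
    exact step_le (mk_pow_eq_one_iff.1 (pow_orderOf_eq_one _))

/-- The subgroup `step g p H` has finite index in `G`, because its index in the finitely generated
group `H` is the order of a finitely generated abelian group of finite exponent. -/
lemma finiteIndex_step [Group.FG G] [H.Normal] [H.FiniteIndex] (hp : p ≠ 0) :
    (step g p H).FiniteIndex := by
  have : Finite (H ⧸ (step g p H).subgroupOf H) := by
    let _ : CommGroup (H ⧸ (step g p H).subgroupOf H) :=
      { (inferInstance : Group (H ⧸ (step g p H).subgroupOf H)) with
        mul_comm := by
          rintro ⟨a⟩ ⟨b⟩
          refine (commutatorElement_eq_one_iff_mul_comm (g₁ := (a : H ⧸ (step g p H).subgroupOf H))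
            (g₂ := b)).1 ?_
          exact (QuotientGroup.eq_one_iff ⁅a, b⁆).2 (commutatorElement_mem_step a.2 b.2) }
    refine CommGroup.finite_of_fg_isMulTorsion _ ?_
    rintro ⟨a⟩
    refine isOfFinOrder_iff_pow_eq_one.2 ⟨p, Nat.pos_of_ne_zero hp, ?_⟩
    exact (QuotientGroup.eq_one_iff (a ^ p)).2 (pow_mem_step a.2)
  refine ⟨?_⟩
  rw [← Subgroup.relIndex_mul_index (step_le (g := g) (p := p) (H := H))]
  refine mul_ne_zero ?_ Subgroup.FiniteIndex.index_ne_zero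
  exact (Subgroup.finiteIndex_of_finite_quotient
    (H := (step g p H).subgroupOf H)).index_ne_zero

/-- The bound `2 ^ (j + 2)` on the orders keeps the number of conditions imposed by the relators
below the index. -/
lemma sum_div_two_pow_lt {n : ℕ} (hn : 0 < n) (J : ℕ) :
    ∑ j ∈ Finset.range J, n / 2 ^ (j + 2) < n := by
  have h := Nat.geom_sum_le (b := 2) le_rfl (n / 4) J
  have h' : ∀ j, n / 2 ^ (j + 2) = n / 4 / 2 ^ j := fun j => by
    rw [Nat.div_div_eq_div_mul, pow_add, mul_comm]
    norm_num
  simp only [h']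
  omega

/-- In a free group of rank at least two every step of the series is strict. -/
theorem step_lt {S : Type*} [Fintype S] (hS : 2 ≤ Fintype.card S) (g : ℕ → FreeGroup S)
    (hp : p.Prime) (H : Subgroup (FreeGroup S)) [H.Normal] [H.FiniteIndex] : step g p H < H := by
  classical
  have : Fact p.Prime := ⟨hp⟩
  let q := QuotientGroup.mk' H
  have hqH : ∀ {h}, q h = 1 ↔ h ∈ H := fun {h} => QuotientGroup.eq_one_iff h
  have hn : 0 < Nat.card (FreeGroup S ⧸ H) := Nat.card_pos
  -- Orders are at most the index of `H`, so only finitely many powers of the `g j` are killed.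
  let A : Finset ℕ := {j ∈ Finset.range (Nat.card (FreeGroup S ⧸ H)) |
    2 ^ (j + 2) ≤ orderOf (q (g j))}
  have hA : ∀ j, 2 ^ (j + 2) ≤ orderOf (q (g j)) → j ∈ A := fun j hj => by
    refine Finset.mem_filter.2 ⟨Finset.mem_range.2 ?_, hj⟩
    calc j < 2 ^ j := Nat.lt_two_pow_self
      _ ≤ 2 ^ (j + 2) := Nat.pow_le_pow_right two_pos (by omega)
      _ ≤ Nat.card (FreeGroup S ⧸ H) := hj.trans (Nat.le_of_dvd hn (orderOf_dvd_natCard _))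
  have hsum : ∑ j : A, Nat.card ((FreeGroup S ⧸ H) ⧸ Subgroup.zpowers (q (g j))) <
      Nat.card (FreeGroup S ⧸ H) := by
    refine lt_of_le_of_lt ?_ (sum_div_two_pow_lt hn (Nat.card (FreeGroup S ⧸ H)))
    rw [Finset.sum_coe_sort A fun j => Nat.card ((FreeGroup S ⧸ H) ⧸ Subgroup.zpowers (q (g j)))]
    refine (Finset.sum_le_sum fun j hj => ?_).trans
      (Finset.sum_le_sum_of_subset (Finset.filter_subset _ _))
    rw [Nat.le_div_iff_mul_le (by positivity),
      Subgroup.card_eq_card_quotient_mul_card_subgroup (Subgroup.zpowers (q (g j))),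
      Nat.card_zpowers]
    exact Nat.mul_le_mul_left _ (Finset.mem_filter.1 hj).2
  obtain ⟨φ, ⟨h, hh, hne⟩, hφ⟩ := exists_cocycle_ne_zero (ZMod p) q (QuotientGroup.mk'_surjective H)
    (fun j : A => g j) (by nlinarith)
  -- The restriction of the crossed homomorphism to `H` is a homomorphism to `ZMod p`.
  let c : H →* Multiplicative (ZMod p) :=
    { toFun := fun a => .ofAdd (genericCocycle (ZMod p) q a 1 φ)
      map_one' := by simp [genericCocycle_one]
      map_mul' := fun a b => by
        simp [genericCocycle_mul, hqH.2 a.2] }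
  have hc : step g p H ≤ c.ker.map H.subtype := by
    refine (Subgroup.closure_le _).2 fun x hx => ?_
    obtain ⟨y, hy, hyx⟩ := Group.mem_conjugatesOfSet_iff.1 hx
    obtain ⟨t, rfl⟩ := isConj_iff.1 hyx
    have hyH : t * y * t⁻¹ ∈ H :=
      ‹H.Normal›.conj_mem _ (step_le (Subgroup.subset_normalClosure hy)) t
    refine ⟨⟨t * y * t⁻¹, hyH⟩, ?_, rfl⟩
    rcases hy with (⟨a, ha, b, hb, rfl⟩ | ⟨a, ha, rfl⟩) | ⟨j, m, hjm, hm, rfl⟩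
    · have ha' := ‹H.Normal›.conj_mem _ ha t
      have hb' := ‹H.Normal›.conj_mem _ hb t
      have : (⟨t * ⁅a, b⁆ * t⁻¹, hyH⟩ : H) =
          ⁅(⟨t * a * t⁻¹, ha'⟩ : H), (⟨t * b * t⁻¹, hb'⟩ : H)⁆ :=
        Subtype.ext (map_commutatorElement (MulAut.conj t) a b)
      rw [SetLike.mem_coe, MonoidHom.mem_ker, this, map_commutatorElement,
        commutatorElement_eq_one_iff_mul_comm, mul_comm]
    · have ha' := ‹H.Normal›.conj_mem _ ha t
      have : (⟨t * a ^ p * t⁻¹, hyH⟩ : H) = (⟨t * a * t⁻¹, ha'⟩ : H) ^ p :=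
        Subtype.ext conj_pow.symm
      rw [SetLike.mem_coe, MonoidHom.mem_ker, this, map_pow]
      refine Multiplicative.toAdd.injective ?_
      rw [toAdd_pow, nsmul_eq_mul, CharP.cast_eq_zero, zero_mul, toAdd_one]
    · have hord : m = orderOf (q (g j)) := Nat.dvd_antisymm
        ((hm _).1 (by rw [← hqH, map_pow, pow_orderOf_eq_one]))
        (orderOf_dvd_iff_pow_eq_one.2 (by rw [← map_pow, hqH, hm]))
      subst hord
      exact congrArg Multiplicative.ofAdd (hφ ⟨j, hA j hjm⟩ t)
  refine lt_of_le_of_ne step_le fun heq => hne ?_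
  obtain ⟨a, ha, hah⟩ := hc (heq.symm ▸ hqH.1 hh)
  subst hah
  exact congrArg Multiplicative.toAdd (MonoidHom.mem_ker.1 ha)

end Step

/-! ### The series and its quotient -/

section Series

open scoped commutatorElement

/-- The descending series of normal subgroups of `G` obtained from `⊤` by iterating `step`. -/
def series {G : Type*} [Group G] (g : ℕ → G) (p : ℕ → ℕ) : ℕ → Subgroup G
  | 0 => ⊤
  | i + 1 => step g (p i) (series g p i)

variable {G : Type*} [Group G] (g : ℕ → G) (p : ℕ → ℕ)

instance series_normal (i : ℕ) : (series g p i).Normal := by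
  cases i with
  | zero => exact inferInstanceAs (⊤ : Subgroup G).Normal
  | succ i => exact inferInstanceAs (step g (p i) (series g p i)).Normal

instance iInf_series_normal : (⨅ i, series g p i).Normal :=
  Subgroup.normal_iInf_normal fun i => series_normal g p i

lemma series_antitone : Antitone (series g p) :=
  antitone_nat_of_succ_le fun _ => step_le

lemma series_finiteIndex [Group.FG G] {p : ℕ → ℕ} (hp : ∀ i, p i ≠ 0) (i : ℕ) :
    (series g p i).FiniteIndex := by
  induction i with
  | zero => exact inferInstanceAs (⊤ : Subgroup G).FiniteIndex
  | succ i ih => exact finiteIndex_step (hp i)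

/-- Every `g j` has finite order modulo the intersection of the series: either its orders modulo
the terms reach `2 ^ (j + 2)` and are constant from then on, or they are bounded. -/
lemma exists_pow_mem_iInf_series (hfin : ∀ i, (series g p i).FiniteIndex) (j : ℕ) :
    ∃ k, 0 < k ∧ g j ^ k ∈ ⨅ i, series g p i := by
  by_cases h : ∃ i, 2 ^ (j + 2) ≤ orderOf (g j : G ⧸ series g p i)
  · obtain ⟨i, hi⟩ := h
    have hconst : ∀ k, i ≤ k →
        orderOf (g j : G ⧸ series g p k) = orderOf (g j : G ⧸ series g p i) := by
      intro k hk
      induction k, hk using Nat.le_induction with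
      | base => rfl
      | succ k _ ih => rw [← ih]; exact orderOf_mk_step (ih ▸ hi)
    refine ⟨orderOf (g j : G ⧸ series g p i), hi.trans_lt' (by positivity), ?_⟩
    refine Subgroup.mem_iInf.2 fun k => ?_
    refine series_antitone g p (le_max_left k i) ?_
    rw [← hconst (max k i) (le_max_right k i)]
    exact mk_pow_eq_one_iff.1 (pow_orderOf_eq_one _)
  · push Not at h
    refine ⟨(2 ^ (j + 2)).factorial, Nat.factorial_pos _, Subgroup.mem_iInf.2 fun i => ?_⟩
    refine mk_pow_eq_one_iff.1 (orderOf_dvd_iff_pow_eq_one.1 ?_)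
    exact Nat.dvd_factorial (orderOf_pos _) (h i).le

/-- The images of the terms of the series form a graded series of the quotient by their
intersection. -/
lemma isPiGraded_quotient_iInf_series {p : ℕ → ℕ} (hp : ∀ i, (p i).Prime) :
    IsPiGraded p (G ⧸ ⨅ i, series g p i) := by
  let N := ⨅ i, series g p i
  have hmem : ∀ i (a : G), (a : G ⧸ N) ∈ (series g p i).map (QuotientGroup.mk' N) ↔
      a ∈ series g p i := by
    intro i a
    refine ⟨?_, fun ha => ⟨a, ha, rfl⟩⟩
    rintro ⟨b, hb, hab⟩
    have h := (series g p i).mul_mem hb (iInf_le (series g p) i (QuotientGroup.eq.1 hab))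
    rwa [mul_inv_cancel_left] at h
  refine ⟨fun i => (series g p i).map (QuotientGroup.mk' N), ?_, ?_, ?_, ?_, ?_⟩
  · exact Subgroup.map_top_of_surjective _ (QuotientGroup.mk'_surjective N)
  · exact fun i => (series_normal g p i).map _ (QuotientGroup.mk'_surjective N)
  · exact fun i => Subgroup.map_mono step_le
  · refine (Subgroup.eq_bot_iff_forall _).2 ?_
    rintro ⟨a⟩ ha
    refine (QuotientGroup.eq_one_iff a).2 (Subgroup.mem_iInf.2 fun i => ?_)
    exact (hmem i a).1 (Subgroup.mem_iInf.1 ha i)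
  · intro i
    have hnormal : ((series g p (i + 1)).map (QuotientGroup.mk' N)).Normal :=
      (series_normal g p (i + 1)).map _ (QuotientGroup.mk'_surjective N)
    set B := ((series g p (i + 1)).map (QuotientGroup.mk' N)).subgroupOf
      ((series g p i).map (QuotientGroup.mk' N))
    have hcomm : ∀ a b : (series g p i).map (QuotientGroup.mk' N) ⧸ B, a * b = b * a := by
      rintro ⟨a⟩ ⟨b⟩
      obtain ⟨x, hx, hxa⟩ := a.2
      obtain ⟨y, hy, hyb⟩ := b.2
      refine (commutatorElement_eq_one_iff_mul_comm (g₁ := (a : _ ⧸ B)) (g₂ := b)).1 ?_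
      refine (QuotientGroup.eq_one_iff ⁅a, b⁆).2 ⟨⁅x, y⁆, commutatorElement_mem_step hx hy, ?_⟩
      rw [map_commutatorElement, hxa, hyb]
      rfl
    have hpow : ∀ a : (series g p i).map (QuotientGroup.mk' N) ⧸ B, a ^ p i = 1 := by
      rintro ⟨⟨-, a, ha, rfl⟩⟩
      refine (QuotientGroup.eq_one_iff (N := B) (_ ^ p i)).2 ?_
      exact ⟨a ^ p i, pow_mem_step ha, rfl⟩
    rcases (Nat.dvd_prime (hp i)).1 (Monoid.exponent_dvd_of_forall_pow_eq_one hpow) with h | h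
    · exact .inl (Monoid.exp_eq_one_iff.1 h)
    · exact .inr ⟨hcomm, h⟩

/-- The quotient by the intersection of a strictly descending series is infinite. -/
lemma infinite_quotient_iInf_series (hlt : ∀ i, series g p (i + 1) < series g p i) :
    Infinite (G ⧸ ⨅ i, series g p i) := by
  refine not_finite_iff_infinite.1 fun hfin => ?_
  have hle : ∀ i, (QuotientGroup.mk' (⨅ i, series g p i)).ker ≤ series g p i := fun i => by
    rw [QuotientGroup.ker_mk']
    exact iInf_le _ i
  refine not_injective_infinite_finite
    (fun i => (series g p i).map (QuotientGroup.mk' (⨅ i, series g p i))) fun i j hij => ?_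
  refine (strictAnti_nat_of_succ_lt hlt).injective ?_
  rw [← Subgroup.comap_map_eq_self (hle i), ← Subgroup.comap_map_eq_self (hle j)]
  exact congrArg (Subgroup.comap _) hij

end Series

theorem theorem2 (p : ℕ → ℕ) (hp : ∀ i, (p i).Prime) :
    ∃ (Q : Type) (_ : Group Q),
      Group.FG Q ∧ Infinite Q ∧ (∀ g : Q, IsOfFinOrder g) ∧ IsPiGraded p Q := by
  obtain ⟨g, hg⟩ := exists_surjective_nat (FreeGroup (Fin 2))
  have hfin := series_finiteIndex g fun i => (hp i).ne_zero
  refine ⟨FreeGroup (Fin 2) ⧸ ⨅ i, series g p i, inferInstance, inferInstance, ?_, ?_,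
    isPiGraded_quotient_iInf_series g hp⟩
  · exact infinite_quotient_iInf_series g p fun i => step_lt (by simp) g (hp i) (series g p i)
  · rintro ⟨x⟩
    obtain ⟨j, rfl⟩ := hg x
    obtain ⟨k, hk, hmem⟩ := exists_pow_mem_iInf_series g p hfin j
    exact isOfFinOrder_iff_pow_eq_one.2 ⟨k, hk, mk_pow_eq_one_iff.2 hmem⟩
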